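/- Conventions. "Analytic" means real analytic; manifolds are Hausdorff and second countable, and have no boundary unless stated otherwise. For a subanalytic set $X\subset\mathbb R^n$, a point $x\in X$ is *smooth of dimension $d$* if it has an open neighbourhood $N$ in $\mathbb R^n$ such that $X\cap N$ is an analytic submanifold of $\mathbb R^n$ of dimension $d$; the set of these points is the *$d$-dimensional smooth part* $\mathrm{Reg}_d(X)$ of $X$, and $\dim X$ is the largest $d$ with $\mathrm{Reg}_d(X)\neq\emptyset$ ($-\infty$ if $X=\emptyset$). Let $X\subset\mathbb R^n$ be a closed subanalytic set of dimension $k$. A *global smoothing section* of $X$ is a triple $\Gamma=(X',\varphi,U)$, where $X'$ is an analytic manifold of pure dimension $k$, $\varphi:X'\to\mathbb R^n$ is a proper analytic map with $\varphi(X')\subset X$, and $U$ is a subset of $\mathrm{Reg}_k(X)$ that is open in it and subanalytic, such that $\dim(X\setminus U)<k$, $\varphi^{-1}(X\setminus U)$ is a simple normal crossings hypersurface of $X'$, and for each connected component $W$ of $U$ the set $\varphi^{-1}(W)$ is the union of a finite positive number of subsets open and closed in $\varphi^{-1}(U)$, each mapped by $\varphi$ isomorphically (as analytic manifolds) onto $W$.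 The number of subsets open and closed in $\varphi^{-1}(U)$ that are mapped isomorphically onto $W$ by $\varphi$ is the *degree of $\Gamma$ over $W$*. A *nonbounding equator* of $X$ is a subset $Y\subset\mathrm{Reg}_k(X)$ such that 1. $Y$ is a compact $C^\infty$ submanifold of $\mathbb R^n$ of dimension $k-1$ (so $k\ge 1$); 2. $Y$ does not bound, that is, $Y$ is not diffeomorphic to the boundary of a compact $C^\infty$ manifold with boundary, of dimension $k$; 3. there is a $C^\infty$ map $\psi:Y\times(-1,1)\to X$ whose image $T$ is an open neighbourhood of $Y$ in $\mathrm{Reg}_k(X)$, which is a $C^\infty$ diffeomorphism onto $T$, and with $\psi(Y\times\{0\})=Y$; 4. for this $\psi$ there is a relatively compact open subset $K$ of $X$ with $\overline K\setminus K=Y$ (closure in $X$) and $K\cap T=\psi(Y\times(-1,0))$. **Corollary.** Let $\Gamma=(X',\varphi,U)$ be a global smoothing section of $X$. (a) Let $W$ be a connected component of $\mathrm{Reg}_k(X)$ which is also a connected component of $U$ (equivalently, $W\subset U$), so that the degree of $\Gamma$ over $W$ is defined. If this degree is $1$, then no nonbounding equator of $X$ is contained in $W$. (b) Consequently, nonexistence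 of nonbounding equators is necessary for a one-to-one smoothing of Hironaka type: if $U=\mathrm{Reg}_k(X)$ and $\Gamma$ has degree $1$ over every connected component of $U$, then $X$ has no nonbounding equator. -/

import Mathlib

open scoped Manifold ContDiff

namespace GlobalSmoothing

/-- A subset `A` of a finite-dimensional normed space is semianalytic if every point `a` of the
ambient space (not only of `A`) has an open neighbourhood `V` on which `A` is a finite union of sets
given by finitely many equations `f = 0` and inequalities `g > 0` with `f`, `g` analytic on `V`.
(Equations and inequalities are listed in pairs; take `f = 0` or `g = 1` to leave one out.) -/
def IsSemianalytic {F : Type*} [NormedAddCommGroup F] [NormedSpace ℝ F] (A : Set F) : Prop :=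
  ∀ a : F, ∃ V : Set F, IsOpen V ∧ a ∈ V ∧
    ∃ (p q : ℕ) (f g : Fin p → Fin q → F → ℝ),
      (∀ i j, AnalyticOnNhd ℝ (f i j) V ∧ AnalyticOnNhd ℝ (g i j) V) ∧
      A ∩ V = {x | x ∈ V ∧ ∃ i, ∀ j, f i j x = 0 ∧ 0 < g i j x}

/-- A subset `X` of a finite-dimensional normed space is subanalytic if every point of the ambient
space has an open neighbourhood `V` such that `X ∩ V` is the projection of a relatively compact
semianalytic subset of `F × ℝᵐ` for some `m`. -/
def IsSubanalytic {F : Type*} [NormedAddCommGroup F] [NormedSpace ℝ F] (X : Set F) : Prop :=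
  ∀ a : F, ∃ V : Set F, IsOpen V ∧ a ∈ V ∧
    ∃ (m : ℕ) (A : Set (F × EuclideanSpace ℝ (Fin m))),
      IsSemianalytic A ∧ IsCompact (closure A) ∧ X ∩ V = Prod.fst '' A

/-- `S` is an embedded (not necessarily closed) submanifold of `ℝⁿ` of class `C^r` and pure
dimension `d` (`r = ∞` smooth, `r = ω` analytic): around each point of `S` there is a
`C^r`-diffeomorphism between open subsets of `ℝⁿ` that straightens `S` to a `d`-dimensional linear
subspace. -/
def IsSubmanifold {n : ℕ} (r : WithTop ℕ∞) (d : ℕ) (S : Set (EuclideanSpace ℝ (Fin n))) : Prop :=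
  ∀ x ∈ S, ∃ (e : OpenPartialHomeomorph (EuclideanSpace ℝ (Fin n)) (EuclideanSpace ℝ (Fin n)))
    (L : Submodule ℝ (EuclideanSpace ℝ (Fin n))),
      x ∈ e.source ∧ ContDiffOn ℝ r e e.source ∧ ContDiffOn ℝ r e.symm e.target ∧
      Module.finrank ℝ L = d ∧ S ∩ e.source = {y | y ∈ e.source ∧ e y ∈ L}

/-- The set of points of `X` that are smooth of dimension `d`. -/
def smoothPart {n : ℕ} (d : ℕ) (X : Set (EuclideanSpace ℝ (Fin n))) :
    Set (EuclideanSpace ℝ (Fin n)) :=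
  {x | x ∈ X ∧ ∃ N : Set (EuclideanSpace ℝ (Fin n)), IsOpen N ∧ x ∈ N ∧ IsSubmanifold ω d (X ∩ N)}

/-- The dimension of a subanalytic set: the largest dimension of its smooth points (`⊥` for the
empty set). -/
noncomputable def dim {n : ℕ} (X : Set (EuclideanSpace ℝ (Fin n))) : WithBot ℕ∞ :=
  ⨆ (d : ℕ) (_ : (smoothPart d X).Nonempty), ((d : ℕ∞) : WithBot ℕ∞)

/-- `W` is a connected component of the subspace `U`. -/
def IsComponentOf {M : Type*} [TopologicalSpace M] (W U : Set M) : Prop :=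
  ∃ x ∈ U, W = connectedComponentIn U x

/-- `A` is a relatively open subset of `S`. -/
def IsOpenIn {M : Type*} [TopologicalSpace M] (A S : Set M) : Prop :=
  ∃ O : Set M, IsOpen O ∧ A = O ∩ S

/-- `f` restricts to a `C^r`-diffeomorphism from the subset `A` of `M` onto the subset `B` of `N`
(an analytic isomorphism for `r = ω`). Here a map on a subset is `C^r` in the sense of
`ContMDiffOn`, which on submanifolds (and on the boundary of a manifold) is the usual notion.
Any two `g` as in the last clause agree on `B`, so the clause speaks of *the* inverse of `f|_A`; it
is written with `∀` so that it also makes sense when `M` is empty. -/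
def IsDiffeoOn {E H M E' H' N : Type*}
    [NormedAddCommGroup E] [NormedSpace ℝ E] [TopologicalSpace H] (I : ModelWithCorners ℝ E H)
    [TopologicalSpace M] [ChartedSpace H M]
    [NormedAddCommGroup E'] [NormedSpace ℝ E'] [TopologicalSpace H'] (J : ModelWithCorners ℝ E' H')
    [TopologicalSpace N] [ChartedSpace H' N]
    (r : WithTop ℕ∞) (f : M → N) (A : Set M) (B : Set N) : Prop :=
  Set.BijOn f A B ∧ ContMDiffOn I J r f A ∧
    ∀ g : N → M, Set.LeftInvOn g f A → ContMDiffOn J I r g B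

/-- `B` is a simple normal crossings hypersurface of the analytic `k`-manifold `M`: it is a union of
subsets `H i` such that every point `a` of `M` has an analytic chart in which the `H i` through `a`
are distinct coordinate hyperplanes and which no other `H i` meets. (So the `H i` are closed smooth
analytic hypersurfaces and form a locally finite family.) -/
def IsSNCHypersurface (k : ℕ) {M : Type} [TopologicalSpace M]
    [ChartedSpace (EuclideanSpace ℝ (Fin k)) M] (B : Set M) : Prop :=
  ∃ (ι : Type) (H : ι → Set M), B = ⋃ i, H i ∧
    ∀ a : M, ∃ e ∈ IsManifold.maximalAtlas (𝓡 k) ω M, a ∈ e.source ∧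
      ∃ c : ι → Fin k, Set.InjOn c {i | a ∈ H i} ∧
        ∀ i, ∀ x ∈ e.source, x ∈ H i ↔ (a ∈ H i ∧ e x (c i) = 0)

/-- The subsets of `φ⁻¹(U)` that are open and closed in `φ⁻¹(U)` and are mapped by `φ`
isomorphically (as analytic manifolds) onto `W`. -/
def sheets {n : ℕ} (k : ℕ) {X' : Type} [TopologicalSpace X']
    [ChartedSpace (EuclideanSpace ℝ (Fin k)) X'] (φ : X' → EuclideanSpace ℝ (Fin n))
    (U W : Set (EuclideanSpace ℝ (Fin n))) : Set (Set X') :=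
  {A | A ⊆ φ ⁻¹' U ∧ IsClopen ((↑) ⁻¹' A : Set (φ ⁻¹' U)) ∧ IsDiffeoOn (𝓡 k) (𝓡 n) ω φ A W}

/-- The degree of `(X', φ, U)` over a connected component `W` of `U`. -/
noncomputable def degree {n : ℕ} (k : ℕ) {X' : Type} [TopologicalSpace X']
    [ChartedSpace (EuclideanSpace ℝ (Fin k)) X'] (φ : X' → EuclideanSpace ℝ (Fin n))
    (U W : Set (EuclideanSpace ℝ (Fin n))) : ℕ :=
  (sheets k φ U W).ncard

/-- `(X', φ, U)` is a global smoothing section of the closed subanalytic set `X ⊆ ℝⁿ` of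
dimension `k`; here `X'` is an analytic manifold of pure dimension `k`. -/
structure IsGlobalSmoothingSection {n : ℕ} (k : ℕ) (X : Set (EuclideanSpace ℝ (Fin n)))
    {X' : Type} [TopologicalSpace X'] [ChartedSpace (EuclideanSpace ℝ (Fin k)) X']
    (φ : X' → EuclideanSpace ℝ (Fin n)) (U : Set (EuclideanSpace ℝ (Fin n))) : Prop where
  proper : IsProperMap φ
  analytic : ContMDiff (𝓡 k) (𝓡 n) ω φ
  range_subset : Set.range φ ⊆ X
  subset_smoothPart : U ⊆ smoothPart k X
  isOpenIn : IsOpenIn U (smoothPart k X)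
  subanalytic : IsSubanalytic U
  dim_diff_lt : dim (X \ U) < ((k : ℕ∞) : WithBot ℕ∞)
  snc : IsSNCHypersurface k (φ ⁻¹' (X \ U))
  covering : ∀ W, IsComponentOf W U →
    (sheets k φ U W).Finite ∧ (sheets k φ U W).Nonempty ∧ φ ⁻¹' W = ⋃₀ sheets k φ U W

/-- `Y ⊆ ℝⁿ`, of dimension `m`, bounds: it is diffeomorphic to the boundary of a compact smooth
`(m + 1)`-dimensional manifold with boundary. -/
def Bounds {n : ℕ} (m : ℕ) (Y : Set (EuclideanSpace ℝ (Fin n))) : Prop :=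
  ∃ (N : Type) (_ : TopologicalSpace N) (_ : T2Space N) (_ : CompactSpace N)
    (_ : ChartedSpace (EuclideanHalfSpace (m + 1)) N) (_ : IsManifold (𝓡∂ (m + 1)) ∞ N)
    (f : N → EuclideanSpace ℝ (Fin n)),
      IsDiffeoOn (𝓡∂ (m + 1)) (𝓡 n) ∞ f ((𝓡∂ (m + 1)).boundary N) Y

/-- `Y` is a nonbounding equator of the closed subanalytic set `X ⊆ ℝⁿ` of dimension `k`. -/
def IsNonboundingEquator {n : ℕ} (k : ℕ) (X Y : Set (EuclideanSpace ℝ (Fin n))) : Prop :=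
  Y ⊆ smoothPart k X ∧
  (∃ m : ℕ, m + 1 = k ∧ IsCompact Y ∧ IsSubmanifold ∞ m Y ∧ ¬ Bounds m Y) ∧
  ∃ (ψ : EuclideanSpace ℝ (Fin n) × ℝ → EuclideanSpace ℝ (Fin n))
    (T K : Set (EuclideanSpace ℝ (Fin n))),
    -- the collar `T` of `Y`
    T = ψ '' (Y ×ˢ Set.Ioo (-1) 1) ∧
    IsOpenIn T (smoothPart k X) ∧
    IsDiffeoOn 𝓘(ℝ, EuclideanSpace ℝ (Fin n) × ℝ) (𝓡 n) ∞ ψ (Y ×ˢ Set.Ioo (-1) 1) T ∧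
    ψ '' (Y ×ˢ {0}) = Y ∧
    -- the relatively compact open subset `K` of `X`, with closure in `X` equal to `X ∩ closure K`
    IsOpenIn K X ∧
    IsCompact (X ∩ closure K) ∧
    (X ∩ closure K) \ K = Y ∧
    K ∩ T = ψ '' (Y ×ˢ Set.Ioo (-1) 0)

end GlobalSmoothing

/-! Let `Y` be an equator with collar `ψ` and inner side `K`, lying in a relatively open `V ⊆ X`
over which `φ` is a diffeomorphism. Set `S = φ⁻¹(X ∩ closure K)`. It is compact because `φ` is
proper. Although `K` may contain singular points of `X`, `φ⁻¹(K)` is open in the manifold `X'`. Near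
`φ⁻¹(Y)`, the collar pulled back through `φ` shows `S` as the side `t ≤ 0` of a hypersurface. Hence
`S` is a compact manifold with boundary `φ⁻¹(Y) ≅ Y`, and `Y` bounds (`not_isNonboundingEquator`).
Degree one is needed only over `V`, to make `φ` a diffeomorphism there.

The manifold structure on `S` is assembled from `IsAdaptedChart`: translated charts at interior
points (`exists_adaptedChart_of_mem_interior`) and collar charts at points over `Y`
(`exists_adaptedChart_of_collar`). -/

namespace GlobalSmoothing

/-! ### Manifolds with corners inside a boundaryless manifold -/

section AdaptedChart

open Set Filter Topology

variable {E H M : Type*} [NormedAddCommGroup E] [NormedSpace ℝ E] [TopologicalSpace H]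
  [TopologicalSpace M] [ChartedSpace E M]

/-- A `C^r` chart `e` of the boundaryless manifold `M` is adapted to `S ⊆ M` if it maps `S` onto the
trace of the range of the model with corners `I`. -/
structure IsAdaptedChart (I : ModelWithCorners ℝ E H) (r : WithTop ℕ∞) (S : Set M)
    (e : OpenPartialHomeomorph M E) : Prop where
  contMDiffOn : ContMDiffOn 𝓘(ℝ, E) 𝓘(ℝ, E) r e e.source
  contMDiffOn_symm : ContMDiffOn 𝓘(ℝ, E) 𝓘(ℝ, E) r e.symm e.target
  mem_iff : ∀ x ∈ e.source, x ∈ S ↔ e x ∈ range I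

variable {I : ModelWithCorners ℝ E H} {r : WithTop ℕ∞} {S : Set M}

open Classical in
/-- The chart of `S` with values in the model space `H` that is induced by an adapted chart. -/
noncomputable def IsAdaptedChart.restrict {e : OpenPartialHomeomorph M E}
    (he : IsAdaptedChart I r S e) (p : S) : OpenPartialHomeomorph S H where
  toFun x := I.symm (e x)
  invFun z := if h : e.symm (I z) ∈ S then ⟨e.symm (I z), h⟩ else p
  source := (↑) ⁻¹' e.source
  target := I ⁻¹' e.target
  map_source' x hx := by
    have h1 : e x ∈ range I := (he.mem_iff x hx).1 x.2
    simpa [I.right_inv h1] using e.map_source hx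
  map_target' z hz := by
    have h : e.symm (I z) ∈ S :=
      (he.mem_iff _ (e.map_target hz)).2 ⟨z, by rw [e.right_inv hz]⟩
    simpa [h] using e.map_target hz
  left_inv' x hx := by
    have h1 : e x ∈ range I := (he.mem_iff x hx).1 x.2
    have h2 : e.symm (e x) = x := e.left_inv hx
    simp [I.right_inv h1, h2]
  right_inv' z hz := by
    have h : e.symm (I z) ∈ S :=
      (he.mem_iff _ (e.map_target hz)).2 ⟨z, by rw [e.right_inv hz]⟩
    simp [h, e.right_inv hz]
  open_source := e.open_source.preimage continuous_subtype_val
  open_target := e.open_target.preimage I.continuous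
  continuousOn_toFun := I.continuous_symm.comp_continuousOn
    (e.continuousOn.comp continuous_subtype_val.continuousOn (mapsTo_preimage _ _))
  continuousOn_invFun := by
    rw [IsInducing.subtypeVal.continuousOn_iff]
    refine (e.continuousOn_symm.comp I.continuous.continuousOn fun _ hz ↦ hz).congr fun z hz ↦ ?_
    have h : e.symm (I z) ∈ S :=
      (he.mem_iff _ (e.map_target hz)).2 ⟨z, by rw [e.right_inv hz]⟩
    simp [h]

section

variable {e : OpenPartialHomeomorph M E} (he : IsAdaptedChart I r S e) (p : S)

theorem IsAdaptedChart.symm_mem {e : OpenPartialHomeomorph M E} (he : IsAdaptedChart I r S e) {z : H} (hz : I z ∈ e.target) : e.symm (I z) ∈ S :=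
  (he.mem_iff _ (e.map_target hz)).2 ⟨z, by rw [e.right_inv hz]⟩

theorem IsAdaptedChart.model_restrict_apply {x : S} (hx : (x : M) ∈ e.source) :
    I (he.restrict p x) = e x :=
  I.right_inv ((he.mem_iff x hx).1 x.2)

theorem IsAdaptedChart.coe_restrict_symm {z : H} (hz : I z ∈ e.target) :
    ((he.restrict p).symm z : M) = e.symm (I z) := by
  have h := he.symm_mem hz
  exact congrArg Subtype.val (dif_pos h)

end

/-- A set that has an adapted chart at each of its points is a manifold with corners. -/
noncomputable abbrev adaptedChartedSpace (c : S → OpenPartialHomeomorph M E)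
    (hc : ∀ p, IsAdaptedChart I r S (c p)) (hmem : ∀ p : S, (p : M) ∈ (c p).source) :
    ChartedSpace H S where
  atlas := range fun p ↦ (hc p).restrict p
  chartAt p := (hc p).restrict p
  mem_chart_source p := hmem p
  chart_mem_atlas p := ⟨p, rfl⟩

variable (c : S → OpenPartialHomeomorph M E)
    (hc : ∀ p, IsAdaptedChart I r S (c p)) (hmem : ∀ p : S, (p : M) ∈ (c p).source)

/-- Read through `I`, the transition maps are restrictions to part of `range I` of the `C^r` maps `c
q ∘ (c p).symm`, defined on open subsets of `E`. -/
theorem isManifold_adapted :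
    letI := adaptedChartedSpace c hc hmem
    IsManifold I r S := by
  let _ := adaptedChartedSpace c hc hmem
  refine isManifold_of_contDiffOn I r S ?_
  rintro _ _ ⟨p, rfl⟩ ⟨q, rfl⟩
  have h : ContDiffOn ℝ r (c q ∘ (c p).symm) ((c p).target ∩ (c p).symm ⁻¹' (c q).source) := by
    rw [← contMDiffOn_iff_contDiffOn]
    exact (hc q).contMDiffOn.comp ((hc p).contMDiffOn_symm.mono inter_subset_left)
      fun x hx ↦ hx.2
  have key : ∀ y ∈ I.symm ⁻¹' (((hc p).restrict p).symm ≫ₕ (hc q).restrict q).source ∩ range I,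
      y ∈ (c p).target ∧ (((hc p).restrict p).symm (I.symm y) : M) = (c p).symm y ∧
        (c p).symm y ∈ (c q).source := by
    rintro _ ⟨hy, z, rfl⟩
    rw [mem_preimage, I.left_inv, OpenPartialHomeomorph.trans_source] at hy
    obtain ⟨h1, h2⟩ := hy
    have h1 : I z ∈ (c p).target := h1
    have h3 := (hc p).coe_restrict_symm p h1
    rw [I.left_inv]
    exact ⟨h1, h3, h3 ▸ h2⟩
  refine (h.mono fun y hy ↦ ⟨(key y hy).1, (key y hy).2.2⟩).congr fun y hy ↦ ?_
  obtain ⟨h1, h2, h3⟩ := key y hy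
  have h4 : (((hc p).restrict p).symm (I.symm y) : M) ∈ (c q).source := h2 ▸ h3
  simp only [Function.comp_apply, OpenPartialHomeomorph.coe_trans]
  rw [(hc q).model_restrict_apply q h4, h2]

theorem isBoundaryPoint_adapted_iff (p : S) :
    letI := adaptedChartedSpace c hc hmem
    I.IsBoundaryPoint p ↔ c p p ∈ frontier (range I) := by
  let _ := adaptedChartedSpace c hc hmem
  change I ((hc p).restrict p p) ∈ _ ↔ _
  rw [(hc p).model_restrict_apply p (hmem p)]

theorem contMDiff_coe_adapted :
    letI := adaptedChartedSpace c hc hmem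
    ContMDiff I 𝓘(ℝ, E) r ((↑) : S → M) := by
  let _ := adaptedChartedSpace c hc hmem
  have := isManifold_adapted c hc hmem
  intro p
  have h1 : ContMDiffOn I I r (chartAt H p) (chartAt H p).source := contMDiffOn_chart
  have h2 : ContMDiffOn I 𝓘(ℝ, E) r (fun x : S ↦ (c p).symm (I (chartAt H p x)))
      (chartAt H p).source := by
    refine (hc p).contMDiffOn_symm.comp (I.contMDiff.comp_contMDiffOn h1) fun x hx ↦ ?_
    exact (chartAt H p).map_source hx
  refine ((h2.congr fun x hx ↦ ?_).contMDiffAt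
    ((chartAt H p).open_source.mem_nhds (mem_chart_source H p)))
  have hx : (x : M) ∈ (c p).source := hx
  change (x : M) = (c p).symm (I ((hc p).restrict p x))
  rw [(hc p).model_restrict_apply p hx, (c p).left_inv hx]

variable {E' H' N : Type*} [NormedAddCommGroup E'] [NormedSpace ℝ E'] [TopologicalSpace H']
  {J : ModelWithCorners ℝ E' H'} [TopologicalSpace N] [ChartedSpace H' N]

/-- Regularity of a map into `S` can be tested in `M`: in a chart the map is `I.symm ∘ c p ∘ g`, and
`I.symm` is smooth on `range I`, where `c p ∘ g` takes its values near `y`. -/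
theorem ContMDiffWithinAt.of_coe_adapted {g : N → S} {A : Set N} {y : N}
    (hg : ContMDiffWithinAt J 𝓘(ℝ, E) r (fun z ↦ (g z : M)) A y) :
    letI := adaptedChartedSpace c hc hmem
    ContMDiffWithinAt J I r g A y := by
  let _ := adaptedChartedSpace c hc hmem
  have := isManifold_adapted c hc hmem
  set p := g y with hp
  have hsrc : {z | (g z : M) ∈ (c p).source} ∈ 𝓝[A] y :=
    hg.continuousWithinAt ((c p).open_source.mem_nhds (hmem p))
  have h1 : ContMDiffWithinAt J 𝓘(ℝ, E) r (fun z ↦ c p (g z)) A y :=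
    ((hc p).contMDiffOn.contMDiffAt ((c p).open_source.mem_nhds (hmem p))).comp_contMDiffWithinAt
      y hg
  have h2 : ContMDiffWithinAt J I r (fun z ↦ I.symm (c p (g z)))
      (A ∩ {z | (g z : M) ∈ (c p).source}) y := by
    refine (I.contMDiffOn_symm (c p p) (((hc p).mem_iff _ (hmem p)).1 p.2)).comp y
      (h1.mono inter_subset_left) fun z hz ↦ ((hc p).mem_iff _ hz.2).1 (g z).2
  have h3 : ContMDiffAt I I r (chartAt H p).symm (I.symm (c p p)) :=
    contMDiffOn_chart_symm.contMDiffAt ((chartAt H p).open_target.mem_nhds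
      ((chartAt H p).map_source (mem_chart_source H p)))
  have h4 := (h3.comp_contMDiffWithinAt y h2).congr_of_eventuallyEq (f₁ := g) ?_ ?_
  · exact h4.mono_of_mem_nhdsWithin (inter_mem self_mem_nhdsWithin hsrc)
  · filter_upwards [self_mem_nhdsWithin] with z hz
    exact ((chartAt H p).left_inv hz.2).symm
  · exact ((chartAt H p).left_inv (mem_chart_source H p)).symm

end AdaptedChart

/-! ### Local connectedness of the smooth part -/

section Components

open Set Topology

theorem isOpenIn_of_forall {M : Type*} [TopologicalSpace M] {A S : Set M} (hAS : A ⊆ S)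
    (h : ∀ x ∈ A, ∃ O, IsOpen O ∧ x ∈ O ∧ O ∩ S ⊆ A) : IsOpenIn A S := by
  choose! O hO hx hA using h
  refine ⟨⋃ x ∈ A, O x, isOpen_biUnion hO, subset_antisymm ?_ ?_⟩
  · exact fun x hxA ↦ ⟨mem_biUnion hxA (hx x hxA), hAS hxA⟩
  · rintro y ⟨hy, hyS⟩
    obtain ⟨x, hxA, hyx⟩ := mem_iUnion₂.1 hy
    exact hA x hxA ⟨hyx, hyS⟩

theorem IsOpenIn.mem_nhdsWithin {M : Type*} [TopologicalSpace M] {A S B : Set M} {x : M}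
    (h : IsOpenIn A S) (hx : x ∈ A) (hB : B ⊆ S) : A ∈ 𝓝[B] x := by
  obtain ⟨O, hO, rfl⟩ := h
  exact Filter.mem_of_superset (inter_mem_nhdsWithin B (hO.mem_nhds hx.1))
    fun y hy ↦ ⟨hy.2, hB hy.1⟩

variable {n : ℕ} {X : Set (EuclideanSpace ℝ (Fin n))} {d : ℕ}

theorem smoothPart_subset : smoothPart d X ⊆ X := fun _ hx ↦ hx.1

theorem isOpenIn_smoothPart : IsOpenIn (smoothPart d X) X :=
  isOpenIn_of_forall smoothPart_subset fun _ ⟨_, N, hN, hxN, hs⟩ ↦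
    ⟨N, hN, hxN, fun _ hy ↦ ⟨hy.2, N, hN, hy.1, hs⟩⟩

/-- A straightening chart identifies `X` near `w` with the convex set `ball ∩ L`. This is what makes
components of the smooth part open in `X`. -/
theorem exists_preconnected_of_smoothPart {w : EuclideanSpace ℝ (Fin n)}
    (hw : w ∈ smoothPart d X) :
    ∃ O, IsOpen O ∧ w ∈ O ∧ IsPreconnected (O ∩ X) ∧ O ∩ X ⊆ smoothPart d X := by
  obtain ⟨hwX, N, hN, hwN, hs⟩ := hw
  obtain ⟨e, L, hwe, -, -, -, heL⟩ := hs w ⟨hwX, hwN⟩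
  have hL : ∀ y ∈ e.source, y ∈ X ∩ N ↔ e y ∈ L := fun y hy ↦
    ⟨fun h ↦ (heL.subset ⟨h, hy⟩).2, fun h ↦ (heL.superset ⟨hy, h⟩).1⟩
  have hmem : e.target ∩ e.symm ⁻¹' N ∈ 𝓝 (e w) :=
    (e.continuousOn_symm.isOpen_inter_preimage e.open_target hN).mem_nhds
      ⟨e.map_source hwe, by rwa [mem_preimage, e.left_inv hwe]⟩
  obtain ⟨ε, hε, hball⟩ := Metric.mem_nhds_iff.1 hmem
  have hN' : ∀ y ∈ e.source, e y ∈ Metric.ball (e w) ε → y ∈ N := fun y hy hyb ↦ by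
    have h := (hball hyb).2
    rwa [mem_preimage, e.left_inv hy] at h
  refine ⟨e.source ∩ e ⁻¹' Metric.ball (e w) ε,
    e.continuousOn.isOpen_inter_preimage e.open_source Metric.isOpen_ball,
    ⟨hwe, mem_preimage.2 (Metric.mem_ball_self hε)⟩, ?_, fun y hy ↦ ⟨hy.2, N, hN, hN' y hy.1.1 hy.1.2, hs⟩⟩
  have himage : (e.source ∩ e ⁻¹' Metric.ball (e w) ε) ∩ X =
      e.symm '' (Metric.ball (e w) ε ∩ L) := by
    refine subset_antisymm ?_ ?_
    · rintro y ⟨⟨hye, hyb⟩, hyX⟩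
      exact ⟨e y, ⟨hyb, (hL y hye).1 ⟨hyX, hN' y hye hyb⟩⟩, e.left_inv hye⟩
    · rintro _ ⟨z, ⟨hzb, hzL⟩, rfl⟩
      have h1 := e.map_target (hball hzb).1
      have h2 := e.right_inv (hball hzb).1
      refine ⟨⟨h1, ?_⟩, ((hL _ h1).2 ?_).1⟩
      · rwa [mem_preimage, h2]
      · rwa [h2]
  rw [himage]
  have hconv : Convex ℝ (Metric.ball (e w) ε ∩ (L : Set (EuclideanSpace ℝ (Fin n)))) :=
    (convex_ball _ _).inter L.convex
  exact hconv.isPreconnected.image _ (e.continuousOn_symm.mono fun z hz ↦ (hball hz.1).1)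

theorem IsComponentOf.isOpenIn {W : Set (EuclideanSpace ℝ (Fin n))}
    (hW : IsComponentOf W (smoothPart d X)) : IsOpenIn W X := by
  obtain ⟨x, -, rfl⟩ := hW
  refine isOpenIn_of_forall ((connectedComponentIn_subset _ _).trans smoothPart_subset)
    fun w hw ↦ ?_
  have hwS := connectedComponentIn_subset _ _ hw
  obtain ⟨O, hO, hwO, hpre, hsub⟩ := exists_preconnected_of_smoothPart hwS
  rw [connectedComponentIn_eq hw]
  exact ⟨O, hO, hwO, hpre.subset_connectedComponentIn ⟨hwO, smoothPart_subset hwS⟩ hsub⟩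

end Components

/-! ### Linear coordinates on the collar -/

section Coordinates

open Module

/-- Coordinates on `L × ℝ`, for `L` an `m`-dimensional subspace, in which the `ℝ`-coordinate comes
first and has its sign changed. -/
theorem exists_collar_coordinates {V : Type*} [NormedAddCommGroup V] [InnerProductSpace ℝ V]
    [FiniteDimensional ℝ V] {m : ℕ} (L : Submodule ℝ V) (hL : finrank ℝ L = m) :
    ∃ (P : V × ℝ →L[ℝ] EuclideanSpace ℝ (Fin (m + 1)))
      (Q : EuclideanSpace ℝ (Fin (m + 1)) →L[ℝ] V × ℝ),
      (∀ v ∈ L, ∀ t, Q (P (v, t)) = (v, t)) ∧ (∀ z, P (Q z) = z) ∧ (∀ z, (Q z).1 ∈ L) ∧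
      ∀ v t, P (v, t) 0 = -t := by
  let ℓ : L ≃ₗ[ℝ] (Fin m → ℝ) := LinearEquiv.ofFinrankEq _ _ (by simp [hL])
  let P : V × ℝ →ₗ[ℝ] EuclideanSpace ℝ (Fin (m + 1)) :=
    -- The minus sign sends the inner side `t ≤ 0` of the collar to the half-space; the orthogonal
    -- projection extends the coordinates of `L` to all of `V`.
    { toFun := fun w ↦ WithLp.toLp 2 (Fin.cons (-w.2) (ℓ (L.orthogonalProjectionOnto w.1)))
      map_add' := fun a b ↦ by
        ext i
        refine Fin.cases ?_ (fun j ↦ ?_) i <;> simp [add_comm]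
      map_smul' := fun a b ↦ by
        ext i
        refine Fin.cases ?_ (fun j ↦ ?_) i <;> simp }
  let Q : EuclideanSpace ℝ (Fin (m + 1)) →ₗ[ℝ] V × ℝ :=
    { toFun := fun z ↦ ((ℓ.symm (fun j ↦ z j.succ) : L), -z 0)
      map_add' := fun a b ↦ by
        have h : (fun j : Fin m ↦ (a + b) j.succ) = (fun j ↦ a j.succ) + fun j ↦ b j.succ := rfl
        refine Prod.ext ?_ (by simp [add_comm])
        rw [h, map_add]
        rfl
      map_smul' := fun a b ↦ by
        have h : (fun j : Fin m ↦ (a • b) j.succ) = a • fun j ↦ b j.succ := rfl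
        refine Prod.ext ?_ (by simp)
        rw [h, map_smul]
        rfl }
  refine ⟨P.toContinuousLinearMap, Q.toContinuousLinearMap, fun v hv t ↦ ?_, fun z ↦ ?_,
    fun z ↦ ?_, fun v t ↦ ?_⟩
  · have h : L.orthogonalProjectionOnto v = ⟨v, hv⟩ :=
      L.orthogonalProjectionOnto_mem_subspace_eq_self ⟨v, hv⟩
    simp [P, Q, h]
  · ext i
    refine Fin.cases ?_ (fun j ↦ ?_) i <;> simp [P, Q]
  · simp [Q]
  · simp [P]

end Coordinates

/-! ### Interior charts and collar charts -/

section Charts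

open Set Topology

variable {m n : ℕ} {M : Type*} [TopologicalSpace M]
  [ChartedSpace (EuclideanSpace ℝ (Fin (m + 1))) M]

theorem exists_adaptedChart_of_mem_interior [IsManifold (𝓡 (m + 1)) ∞ M] {S : Set M} {p : M}
    (hp : p ∈ interior S) :
    ∃ e : OpenPartialHomeomorph M (EuclideanSpace ℝ (Fin (m + 1))),
      IsAdaptedChart (𝓡∂ (m + 1)) ∞ S e ∧ p ∈ e.source ∧ 0 < e p 0 := by
  set e₀ := chartAt (EuclideanSpace ℝ (Fin (m + 1))) p
  -- Translating by `v` sends `p` to the first basis vector, inside the open half-space. After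
  -- shrinking, both sides of the adaptedness condition always hold.
  let v : EuclideanSpace ℝ (Fin (m + 1)) := EuclideanSpace.single 0 1 - e₀ p
  let e₁ := e₀.transHomeomorph (Homeomorph.addRight v)
  have hpos : IsOpen {z : EuclideanSpace ℝ (Fin (m + 1)) | 0 < z 0} :=
    isOpen_lt continuous_const (EuclideanSpace.proj 0).continuous
  have hO : IsOpen (interior S ∩ (e₁.source ∩ e₁ ⁻¹' {z | 0 < z 0})) :=
    isOpen_interior.inter (e₁.continuousOn.isOpen_inter_preimage e₁.open_source hpos)
  have hp1 : 0 < e₁ p 0 := by simp [e₁, v]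
  have he₁ : ContMDiffOn (𝓡 (m + 1)) (𝓡 (m + 1)) ∞ e₁ e₁.source :=
    (contDiff_id.add contDiff_const).contMDiff.comp_contMDiffOn contMDiffOn_chart
  have he₁' : ContMDiffOn (𝓡 (m + 1)) (𝓡 (m + 1)) ∞ e₁.symm e₁.target :=
    contMDiffOn_chart_symm.comp (contDiff_id.add contDiff_const).contMDiff.contMDiffOn
      fun z hz ↦ hz
  refine ⟨e₁.restrOpen _ hO, ⟨he₁.mono inter_subset_left, he₁'.mono inter_subset_left, ?_⟩,
    ⟨mem_chart_source _ p, hp, mem_chart_source _ p, hp1⟩, hp1⟩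
  intro x hx
  rw [range_modelWithCornersEuclideanHalfSpace]
  have hx0 : 0 < e₁ x 0 := hx.2.2.2
  exact ⟨fun _ ↦ hx0.le, fun _ ↦ interior_subset hx.2.1⟩

/-- The chart sends `x` to the collar coordinates `(y, t) = ψ⁻¹(φ x)`, then straightens `y` by a
submanifold chart of `Y` and flips the sign of `t`. -/
theorem exists_adaptedChart_of_collar {φ : M → EuclideanSpace ℝ (Fin n)}
    (hφ : ContMDiff (𝓡 (m + 1)) (𝓡 n) ∞ φ) {X V Y T : Set (EuclideanSpace ℝ (Fin n))}
    (hX : range φ ⊆ X) (hV : IsOpenIn V X)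
    (hφV : IsDiffeoOn (𝓡 (m + 1)) (𝓡 n) ∞ φ (φ ⁻¹' V) V) (hY : IsSubmanifold ∞ m Y)
    {ψ : EuclideanSpace ℝ (Fin n) × ℝ → EuclideanSpace ℝ (Fin n)} (hT : IsOpenIn T X)
    (hψ : IsDiffeoOn 𝓘(ℝ, EuclideanSpace ℝ (Fin n) × ℝ) (𝓡 n) ∞ ψ (Y ×ˢ Ioo (-1) 1) T)
    {S : Set M}
    (hS : ∀ x, ∀ y ∈ Y, ∀ t ∈ Ioo (-1 : ℝ) 1, φ x = ψ (y, t) → (x ∈ S ↔ t ≤ 0))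
    {p : M} {y₀ : EuclideanSpace ℝ (Fin n)} (hy₀ : y₀ ∈ Y) (hp : φ p = ψ (y₀, 0))
    (hpV : φ p ∈ V) :
    ∃ e : OpenPartialHomeomorph M (EuclideanSpace ℝ (Fin (m + 1))),
      IsAdaptedChart (𝓡∂ (m + 1)) ∞ S e ∧ p ∈ e.source ∧ e p 0 = 0 := by
  have : Nonempty M := ⟨p⟩
  have hXφ : ∀ x, φ x ∈ X := fun x ↦ hX ⟨x, rfl⟩
  have hTX : T ⊆ X := by
    obtain ⟨O, -, rfl⟩ := hT
    exact inter_subset_right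
  have hVopen : ∃ O, IsOpen O ∧ V = O ∩ X := hV
  obtain ⟨OV, hOV, hVeq⟩ := hVopen
  have hTopen : ∃ O, IsOpen O ∧ T = O ∩ X := hT
  obtain ⟨OT, hOT, hTeq⟩ := hTopen
  -- `T` and `V` are only relatively open in `X`, but `φ` takes values in `X`.
  have hφT_open : IsOpen (φ ⁻¹' T) := by
    have h : φ ⁻¹' T = φ ⁻¹' OT := by
      ext x
      simp [hTeq, hXφ x]
    exact h ▸ hOT.preimage hφ.continuous
  have hφV_open : IsOpen (φ ⁻¹' V) := by
    have h : φ ⁻¹' V = φ ⁻¹' OV := by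
      ext x
      simp [hVeq, hXφ x]
    exact h ▸ hOV.preimage hφ.continuous
  obtain ⟨hψbij, hψsmooth, hψinv⟩ := hψ
  obtain ⟨hφbij, -, hφinv⟩ := hφV
  set D : Set (EuclideanSpace ℝ (Fin n) × ℝ) := Y ×ˢ Ioo (-1) 1
  set g := Function.invFunOn ψ D
  have hgl : LeftInvOn g ψ D := hψbij.injOn.leftInvOn_invFunOn
  have hgr : ∀ z ∈ T, g z ∈ D ∧ ψ (g z) = z := fun z hz ↦
    Function.invFunOn_pos (hψbij.surjOn hz)
  set h := Function.invFunOn φ (φ ⁻¹' V)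
  have hhl : LeftInvOn h φ (φ ⁻¹' V) := hφbij.injOn.leftInvOn_invFunOn
  have hhr : ∀ z ∈ V, h z ∈ φ ⁻¹' V ∧ φ (h z) = z := fun z hz ↦
    Function.invFunOn_pos (hφbij.surjOn hz)
  obtain ⟨e, L, hye, he, he', hL, heL⟩ := hY y₀ hy₀
  have hYL : ∀ y ∈ e.source, y ∈ Y ↔ e y ∈ L := fun y hy ↦
    ⟨fun h ↦ (heL.subset ⟨h, hy⟩).2, fun h ↦ (heL.superset ⟨hy, h⟩).1⟩
  obtain ⟨P, Q, hQP, hPQ, hQL, hP0⟩ := exists_collar_coordinates L hL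
  let A : EuclideanSpace ℝ (Fin n) × ℝ → EuclideanSpace ℝ (Fin (m + 1)) :=
    fun w ↦ P (e w.1, w.2)
  let B : EuclideanSpace ℝ (Fin (m + 1)) → EuclideanSpace ℝ (Fin n) × ℝ :=
    fun z ↦ (e.symm (Q z).1, (Q z).2)
  have hA : ContDiffOn ℝ ∞ A (Prod.fst ⁻¹' e.source) :=
    P.contDiff.comp_contDiffOn
      ((he.comp contDiff_fst.contDiffOn (mapsTo_preimage _ _)).prodMk contDiff_snd.contDiffOn)
  have hB : ContDiffOn ℝ ∞ B ((fun z ↦ (Q z).1) ⁻¹' e.target) :=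
    (he'.comp (contDiff_fst.comp Q.contDiff).contDiffOn (mapsTo_preimage _ _)).prodMk
      (contDiff_snd.comp Q.contDiff).contDiffOn
  set s : Set M := (φ ⁻¹' T ∩ (fun x ↦ g (φ x)) ⁻¹' (Prod.fst ⁻¹' e.source)) ∩ φ ⁻¹' V with hs
  set t₀ : Set (EuclideanSpace ℝ (Fin (m + 1))) :=
    (fun z ↦ (Q z).1) ⁻¹' e.target ∩ (fun z ↦ (Q z).2) ⁻¹' Ioo (-1) 1 with ht₀
  -- Intersecting with the preimage of `OV` forces `ψ (B z) ∈ V`, where `h` inverts `φ`.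
  set t : Set (EuclideanSpace ℝ (Fin (m + 1))) := t₀ ∩ (fun z ↦ ψ (B z)) ⁻¹' OV with ht
  have hBD : MapsTo B t₀ D := fun z hz ↦ by
    refine ⟨(hYL _ (e.map_target hz.1)).2 ?_, hz.2⟩
    rw [e.right_inv hz.1]
    exact hQL z
  have hgφ : ContMDiffOn (𝓡 (m + 1)) 𝓘(ℝ, EuclideanSpace ℝ (Fin n) × ℝ) ∞ (fun x ↦ g (φ x))
      (φ ⁻¹' T) := (hψinv g hgl).comp hφ.contMDiffOn (mapsTo_preimage _ _)
  have hψB : ContMDiffOn (𝓡 (m + 1)) (𝓡 n) ∞ (fun z ↦ ψ (B z)) t₀ :=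
    hψsmooth.comp (hB.contMDiffOn.mono inter_subset_left) hBD
  have hs_open : IsOpen s :=
    (hgφ.continuousOn.isOpen_inter_preimage hφT_open
      (e.open_source.preimage continuous_fst)).inter hφV_open
  have ht₀_open : IsOpen t₀ :=
    (e.open_target.preimage (continuous_fst.comp Q.continuous)).inter
      (isOpen_Ioo.preimage (continuous_snd.comp Q.continuous))
  have ht_open : IsOpen t := hψB.continuousOn.isOpen_inter_preimage ht₀_open hOV
  have hF : ContMDiffOn (𝓡 (m + 1)) (𝓡 (m + 1)) ∞ (fun x ↦ A (g (φ x))) s :=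
    hA.contMDiffOn.comp (hgφ.mono fun x hx ↦ hx.1.1) fun x hx ↦ hx.1.2
  have hBV : ∀ z ∈ t, ψ (B z) ∈ V := fun z hz ↦
    hVeq ▸ ⟨hz.2, hTX (hψbij.mapsTo (hBD hz.1))⟩
  have hG : ContMDiffOn (𝓡 (m + 1)) (𝓡 (m + 1)) ∞ (fun z ↦ h (ψ (B z))) t :=
    (hφinv h hhl).comp (hψB.mono inter_subset_left) hBV
  have hBA : ∀ x ∈ s, Q (A (g (φ x))) = (e (g (φ x)).1, (g (φ x)).2) ∧
      B (A (g (φ x))) = g (φ x) := fun x hx ↦ by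
    have h1 : Q (A (g (φ x))) = (e (g (φ x)).1, (g (φ x)).2) :=
      hQP _ ((hYL _ hx.1.2).1 (hgr _ hx.1.1).1.1) _
    refine ⟨h1, ?_⟩
    change (e.symm (Q (A (g (φ x)))).1, (Q (A (g (φ x)))).2) = _
    rw [h1, e.left_inv hx.1.2]
  have hgψB : ∀ z ∈ t, φ (h (ψ (B z))) = ψ (B z) ∧ g (φ (h (ψ (B z)))) = B z := fun z hz ↦ by
    have h1 := (hhr _ (hBV z hz)).2
    exact ⟨h1, by rw [h1, hgl (hBD hz.1)]⟩
  let c : OpenPartialHomeomorph M (EuclideanSpace ℝ (Fin (m + 1))) :=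
    { toFun := fun x ↦ A (g (φ x))
      invFun := fun z ↦ h (ψ (B z))
      source := s
      target := t
      map_source' := fun x hx ↦ by
        obtain ⟨h1, h2⟩ := hBA x hx
        refine ⟨⟨?_, ?_⟩, ?_⟩
        · rw [mem_preimage, h1]
          exact e.map_source hx.1.2
        · rw [mem_preimage, h1]
          exact (hgr _ hx.1.1).1.2
        · rw [mem_preimage, h2, (hgr _ hx.1.1).2]
          exact (hVeq.subset hx.2).1
      map_target' := fun z hz ↦ by
        obtain ⟨h1, h2⟩ := hgψB z hz
        refine ⟨⟨?_, ?_⟩, (hhr _ (hBV z hz)).1⟩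
        · rw [mem_preimage, h1]
          exact hψbij.mapsTo (hBD hz.1)
        · rw [mem_preimage, h2]
          exact e.map_target hz.1.1
      left_inv' := fun x hx ↦ by
        rw [(hBA x hx).2, (hgr _ hx.1.1).2, hhl hx.2]
      right_inv' := fun z hz ↦ by
        rw [(hgψB z hz).2]
        change P (e (e.symm (Q z).1), (Q z).2) = z
        rw [e.right_inv hz.1.1]
        exact hPQ z
      open_source := hs_open
      open_target := ht_open
      continuousOn_toFun := hF.continuousOn
      continuousOn_invFun := hG.continuousOn }
  have hc0 : ∀ x, c x 0 = -(g (φ x)).2 := fun x ↦ hP0 _ _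
  have h0 : (y₀, (0 : ℝ)) ∈ D := ⟨hy₀, by norm_num⟩
  have hgp : g (φ p) = (y₀, 0) := by rw [hp, hgl h0]
  have hps : p ∈ s := by
    refine ⟨⟨?_, ?_⟩, hpV⟩
    · rw [mem_preimage, hp]
      exact hψbij.mapsTo h0
    · simpa only [mem_preimage, hgp] using hye
  refine ⟨c, ⟨hF, hG, fun x hx ↦ ?_⟩, hps, by rw [hc0, hgp, neg_zero]⟩
  rw [range_modelWithCornersEuclideanHalfSpace, mem_ofPred_eq, hc0, neg_nonneg]
  obtain ⟨hgD, hgx⟩ := hgr _ hx.1.1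
  exact hS x _ hgD.1 _ hgD.2 hgx.symm

end Charts

/-! ### The compact domain bounded by the equator -/

section Bounding

open Set Topology

theorem IsOpenIn.trans {M : Type*} [TopologicalSpace M] {A B C : Set M} (hAB : IsOpenIn A B)
    (hBC : IsOpenIn B C) : IsOpenIn A C := by
  obtain ⟨O, hO, rfl⟩ := hAB
  obtain ⟨O', hO', rfl⟩ := hBC
  exact ⟨O ∩ O', hO.inter hO', (inter_assoc _ _ _).symm⟩

variable {n : ℕ}

/-- If `S` is a compact domain in `M` whose boundary `{x ∈ S | φ x ∈ Y}` is mapped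
diffeomorphically onto `Y`, then `Y` bounds. -/
theorem bounds_of_adaptedCharts {m : ℕ} {M : Type} [TopologicalSpace M] [T2Space M]
    [ChartedSpace (EuclideanSpace ℝ (Fin (m + 1))) M] {φ : M → EuclideanSpace ℝ (Fin n)}
    (hφ : ContMDiff (𝓡 (m + 1)) (𝓡 n) ∞ φ) {V Y : Set (EuclideanSpace ℝ (Fin n))}
    (hφV : IsDiffeoOn (𝓡 (m + 1)) (𝓡 n) ∞ φ (φ ⁻¹' V) V) (hYV : Y ⊆ V)
    {S : Set M} (hS : IsCompact S) (hYS : φ ⁻¹' Y ⊆ S)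
    (hbdry : ∀ p ∈ S, φ p ∈ Y → ∃ e : OpenPartialHomeomorph M (EuclideanSpace ℝ (Fin (m + 1))),
      IsAdaptedChart (𝓡∂ (m + 1)) ∞ S e ∧ p ∈ e.source ∧ e p 0 = 0)
    (hint : ∀ p ∈ S, φ p ∉ Y → ∃ e : OpenPartialHomeomorph M (EuclideanSpace ℝ (Fin (m + 1))),
      IsAdaptedChart (𝓡∂ (m + 1)) ∞ S e ∧ p ∈ e.source ∧ 0 < e p 0) :
    Bounds m Y := by
  have hchart : ∀ p : S, ∃ e : OpenPartialHomeomorph M (EuclideanSpace ℝ (Fin (m + 1))),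
      IsAdaptedChart (𝓡∂ (m + 1)) ∞ S e ∧ (p : M) ∈ e.source ∧ (0 = e p 0 ↔ φ p ∈ Y) := by
    intro p
    by_cases hp : φ p ∈ Y
    · obtain ⟨e, he, hpe, h0⟩ := hbdry p p.2 hp
      exact ⟨e, he, hpe, iff_of_true h0.symm hp⟩
    · obtain ⟨e, he, hpe, h0⟩ := hint p p.2 hp
      exact ⟨e, he, hpe, iff_of_false h0.ne hp⟩
  choose c hc hmem hY using hchart
  let _ := adaptedChartedSpace c hc hmem
  have hman : IsManifold (𝓡∂ (m + 1)) ∞ S := isManifold_adapted c hc hmem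
  have hcoe : ContMDiff (𝓡∂ (m + 1)) (𝓡 (m + 1)) ∞ ((↑) : S → M) :=
    contMDiff_coe_adapted c hc hmem
  have hbd : ∀ p : S, p ∈ (𝓡∂ (m + 1)).boundary S ↔ φ p ∈ Y := fun p ↦ by
    rw [← hY p]
    refine (isBoundaryPoint_adapted_iff c hc hmem p).trans ?_
    rw [frontier_range_modelWithCornersEuclideanHalfSpace]
    rfl
  refine ⟨S, inferInstance, inferInstance, isCompact_iff_compactSpace.1 hS, inferInstance, hman,
    fun p ↦ φ p, ⟨?_, ?_, ?_⟩, (hφ.comp hcoe).contMDiffOn, fun g hg y hy ↦ ?_⟩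
  · exact fun p hp ↦ (hbd p).1 hp
  · exact fun p hp q hq hpq ↦
      Subtype.ext (hφV.1.injOn (hYV ((hbd p).1 hp)) (hYV ((hbd q).1 hq)) hpq)
  · intro y hy
    obtain ⟨x, -, rfl⟩ := hφV.1.surjOn (hYV hy)
    exact ⟨⟨x, hYS hy⟩, (hbd _).2 hy, rfl⟩
  -- On `Y`, the given inverse `g`, viewed in `M`, agrees with the smooth inverse of `φ` over `V`.
  · have : Nonempty M := ⟨g y⟩
    have hl : LeftInvOn (Function.invFunOn φ (φ ⁻¹' V)) φ (φ ⁻¹' V) :=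
      hφV.1.injOn.leftInvOn_invFunOn
    refine ContMDiffWithinAt.of_coe_adapted c hc hmem ?_
    refine (((hφV.2.2 _ hl).mono hYV).congr fun z hz ↦ ?_) y hy
    obtain ⟨x, hx, rfl⟩ := hφV.1.surjOn (hYV hz)
    have h1 : g (φ x) = ⟨x, hYS hz⟩ := hg (x := ⟨x, hYS hz⟩) ((hbd _).2 hz)
    rw [h1, hl hx]

/-- A compact hypersurface that is separated by a collar, and above a neighbourhood of which a
proper map is one-to-one, bounds. -/
theorem not_isNonboundingEquator {k : ℕ} {M : Type} [TopologicalSpace M] [T2Space M]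
    [ChartedSpace (EuclideanSpace ℝ (Fin k)) M] [IsManifold (𝓡 k) ∞ M]
    {X V Y : Set (EuclideanSpace ℝ (Fin n))} {φ : M → EuclideanSpace ℝ (Fin n)}
    (hφ : ContMDiff (𝓡 k) (𝓡 n) ∞ φ) (hproper : IsProperMap φ) (hX : range φ ⊆ X)
    (hV : IsOpenIn V X) (hφV : IsDiffeoOn (𝓡 k) (𝓡 n) ∞ φ (φ ⁻¹' V) V) (hYV : Y ⊆ V) :
    ¬ IsNonboundingEquator k X Y := by
  rintro ⟨-, ⟨m, rfl, -, hYsub, hYb⟩, ψ, T, K, -, hT, hψ, hψ0, hK, hKc, hKY, hKT⟩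
  refine hYb ?_
  have hXφ : ∀ x, φ x ∈ X := fun x ↦ hX ⟨x, rfl⟩
  have hYcl : Y ⊆ X ∩ closure K := hKY ▸ sdiff_subset
  have hKcl : K ⊆ X ∩ closure K := by
    obtain ⟨O, -, hO⟩ := hK
    exact subset_inter (hO.subset.trans inter_subset_right) subset_closure
  have hKint : φ ⁻¹' K ⊆ interior (φ ⁻¹' (X ∩ closure K)) := by
    obtain ⟨O, hO, hKO⟩ := hK
    have h : φ ⁻¹' K = φ ⁻¹' O := by
      ext x
      simp [hKO, hXφ x]
    exact interior_maximal (preimage_mono hKcl) (h ▸ hO.preimage hφ.continuous)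
  refine bounds_of_adaptedCharts hφ hφV hYV (hproper.isCompact_preimage hKc)
    (preimage_mono hYcl) (fun p _ hpY ↦ ?_) fun p hpS hpY ↦ ?_
  · obtain ⟨⟨y₀, t₀⟩, ⟨hy₀, ht₀⟩, hp⟩ := hψ0.superset hpY
    obtain rfl : t₀ = 0 := ht₀
    refine exists_adaptedChart_of_collar hφ hX hV hφV hYsub (hT.trans isOpenIn_smoothPart) hψ
      (fun x y hy t ht hx ↦ ?_) hy₀ hp.symm (hYV hpY)
    have hyt : (y, t) ∈ Y ×ˢ Ioo (-1 : ℝ) 1 := ⟨hy, ht⟩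
    have h0 : ∀ y ∈ Y, (y, (0 : ℝ)) ∈ Y ×ˢ Ioo (-1 : ℝ) 1 := fun y hy ↦ ⟨hy, by norm_num⟩
    rw [mem_preimage, hx]
    constructor
    -- A collar point in the closure of `K` lies either in `K`, so that `t < 0`, or in `Y`, so that
    -- `t = 0`, by injectivity of `ψ`.
    · intro hcl
      by_cases hxK : ψ (y, t) ∈ K
      · obtain ⟨⟨y', t'⟩, ⟨hy', ht'⟩, h⟩ := hKT.subset ⟨hxK, hψ.1.mapsTo hyt⟩
        have h1 := hψ.1.injOn ⟨hy', ht'.1, ht'.2.trans one_pos⟩ hyt h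
        exact (Prod.ext_iff.1 h1).2.ge.trans ht'.2.le
      · obtain ⟨⟨y', t'⟩, ⟨hy', ht'⟩, h⟩ := hψ0.superset (hKY.subset ⟨hcl, hxK⟩)
        obtain rfl : t' = 0 := ht'
        exact (Prod.ext_iff.1 (hψ.1.injOn (h0 y' hy') hyt h)).2.ge
    · intro ht0
      rcases ht0.lt_or_eq with ht0 | rfl
      · exact hKcl (hKT.superset ⟨(y, t), ⟨hy, ht.1, ht0⟩, rfl⟩).1
      · exact hYcl (hψ0.subset ⟨(y, 0), ⟨hy, rfl⟩, rfl⟩)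
  · refine exists_adaptedChart_of_mem_interior (hKint ?_)
    by_contra hpK
    exact hpY (hKY.subset ⟨hpS, hpK⟩)

end Bounding

/-! ### Degree one gives a diffeomorphism -/

section Degree

open Set Topology

variable {n k : ℕ} {X U W : Set (EuclideanSpace ℝ (Fin n))} {M : Type} [TopologicalSpace M]
  [ChartedSpace (EuclideanSpace ℝ (Fin k)) M] {φ : M → EuclideanSpace ℝ (Fin n)}

/-- The sheets cover `φ⁻¹(W)`, so a single sheet is all of it. -/
theorem IsGlobalSmoothingSection.isDiffeoOn_of_degree_eq_one
    (hΓ : IsGlobalSmoothingSection k X φ U) (hW : IsComponentOf W U)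
    (hdeg : degree k φ U W = 1) : IsDiffeoOn (𝓡 k) (𝓡 n) ∞ φ (φ ⁻¹' W) W := by
  obtain ⟨A, hA⟩ := ncard_eq_one.1 hdeg
  have h1 : φ ⁻¹' W = A := by rw [(hΓ.covering W hW).2.2, hA, sUnion_singleton]
  obtain ⟨-, -, hbij, hsm, hinv⟩ : A ∈ sheets k φ U W := hA ▸ mem_singleton A
  rw [h1]
  exact ⟨hbij, hsm.of_le (by simp), fun g hg ↦ (hinv g hg).of_le (by simp)⟩

/-- Points with equal image lie over the same component, which gives injectivity; smoothness of the
inverse is local because components are open in `U`. -/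
theorem isDiffeoOn_of_components (hφ : ContMDiff (𝓡 k) (𝓡 n) ∞ φ)
    (hopen : ∀ W, IsComponentOf W U → IsOpenIn W U)
    (h : ∀ W, IsComponentOf W U → IsDiffeoOn (𝓡 k) (𝓡 n) ∞ φ (φ ⁻¹' W) W) :
    IsDiffeoOn (𝓡 k) (𝓡 n) ∞ φ (φ ⁻¹' U) U := by
  refine ⟨⟨mapsTo_preimage _ _, fun x hx y hy hxy ↦ ?_, fun u hu ↦ ?_⟩, hφ.contMDiffOn,
    fun g hg u hu ↦ ?_⟩
  · exact (h _ ⟨φ x, hx, rfl⟩).1.injOn (mem_connectedComponentIn hx)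
      (by rw [mem_preimage, ← hxy]; exact mem_connectedComponentIn hx) hxy
  · obtain ⟨x, -, rfl⟩ := (h _ ⟨u, hu, rfl⟩).1.surjOn (mem_connectedComponentIn hu)
    exact ⟨x, hu, rfl⟩
  · have hW : IsComponentOf (connectedComponentIn U u) U := ⟨u, hu, rfl⟩
    have hsub := connectedComponentIn_subset U u
    exact ((h _ hW).2.2 g (hg.mono (preimage_mono hsub)) u
      (mem_connectedComponentIn hu)).mono_of_mem_nhdsWithin
        ((hopen _ hW).mem_nhdsWithin (mem_connectedComponentIn hu) subset_rfl)

end Degree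

end GlobalSmoothing

theorem mainTheorem2 {n k : ℕ} (X : Set (EuclideanSpace ℝ (Fin n)))
    (hX_closed : IsClosed X) (hX_sub : GlobalSmoothing.IsSubanalytic X)
    (hX_dim : GlobalSmoothing.dim X = ((k : ℕ∞) : WithBot ℕ∞))
    {X' : Type} [TopologicalSpace X'] [T2Space X'] [SecondCountableTopology X']
    [ChartedSpace (EuclideanSpace ℝ (Fin k)) X'] [IsManifold (𝓡 k) ω X']
    (φ : X' → EuclideanSpace ℝ (Fin n)) (U : Set (EuclideanSpace ℝ (Fin n)))
    (hΓ : GlobalSmoothing.IsGlobalSmoothingSection k X φ U) :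
    (∀ W : Set (EuclideanSpace ℝ (Fin n)),
      GlobalSmoothing.IsComponentOf W (GlobalSmoothing.smoothPart k X) →
      GlobalSmoothing.IsComponentOf W U →
      GlobalSmoothing.degree k φ U W = 1 →
      ¬ ∃ Y ⊆ W, GlobalSmoothing.IsNonboundingEquator k X Y) ∧
    (U = GlobalSmoothing.smoothPart k X →
      (∀ W, GlobalSmoothing.IsComponentOf W U → GlobalSmoothing.degree k φ U W = 1) →
      ¬ ∃ Y, GlobalSmoothing.IsNonboundingEquator k X Y) := by
  have hman : IsManifold (𝓡 k) ∞ X' := IsManifold.of_le (n := ω) (by simp)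
  have hφ : ContMDiff (𝓡 k) (𝓡 n) ∞ φ := hΓ.analytic.of_le (by simp)
  constructor
  · rintro W hWX hWU hdeg ⟨Y, hYW, hY⟩
    exact GlobalSmoothing.not_isNonboundingEquator hφ hΓ.proper hΓ.range_subset hWX.isOpenIn
      (hΓ.isDiffeoOn_of_degree_eq_one hWU hdeg) hYW hY
  · rintro rfl hdeg ⟨Y, hY⟩
    -- An equator need not be connected and may meet several components, so `V` is the whole smooth
    -- part here.
    refine GlobalSmoothing.not_isNonboundingEquator hφ hΓ.proper hΓ.range_subset
      GlobalSmoothing.isOpenIn_smoothPart (GlobalSmoothing.isDiffeoOn_of_components hφ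
        (fun W hW ↦ ?_) fun W hW ↦ hΓ.isDiffeoOn_of_degree_eq_one hW (hdeg W hW)) hY.1 hY
    obtain ⟨O, hO, hWO⟩ := hW.isOpenIn
    obtain ⟨x, hx, rfl⟩ := hW
    refine ⟨O, hO, Set.Subset.antisymm (fun y hy ↦ ⟨(hWO.subset hy).1,
      connectedComponentIn_subset _ _ hy⟩) fun y hy ↦ hWO.superset ⟨hy.1, hy.2.1⟩⟩
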